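/- A convex geometry on a finite set $X$ is a closure operator $\varphi : 2^X \to 2^X$ (that is, $Y \subseteq \varphi(Y)$, $Y \subseteq Z$ implies $\varphi(Y) \subseteq \varphi(Z)$, and $\varphi(\varphi(Y)) = \varphi(Y)$) such that $\varphi(\emptyset) = \emptyset$ and, for every closed set $Y = \varphi(Y)$ and all distinct $x, y \in X \setminus Y$, if $x \in \varphi(Y \cup \{y\})$ then $y \notin \varphi(Y \cup \{x\})$. An isomorphism from $(X, \varphi)$ to $(X', \varphi')$, where $\varphi'$ is an operator on $2^{X'}$, is a bijection $e : X \to X'$ with $e(\varphi(Y)) = \varphi'(e(Y))$ for all $Y \subseteq X$. For a finite set $S$ of circles in $\mathbb{R}^2$, where radius $0$ (a point) is allowed, and $T \subseteq S$, let $$\mathrm{ch}_c(T) = \Big\{ x \in S : \tilde{x} \subseteq \mathrm{CH}\Big(\bigcup_{y \in T} \tilde{y}\Big) \Big\},$$ where $\tilde{x}$ is the set of points of the circle $x$ and $\mathrm{CH}$ denotes the convex hull in $\mathbb{R}^2$. Let $X$ be a set with $4$ elements. Then there are, up to isomorphism, exactly $34$ convex geometries on $X$, and every one of them is representable by circles: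 for every convex geometry $(X, \varphi)$ there is a set $S$ of four circles in $\mathbb{R}^2$ such that $(X, \varphi)$ is isomorphic to $(S, \mathrm{ch}_c)$. -/

import Mathlib

/-- The Euclidean plane. -/
abbrev Plane : Type := EuclideanSpace ℝ (Fin 2)

/-- A closure operator `φ` on the subsets of `X` is a convex geometry if `φ ∅ = ∅` and it has the
anti-exchange property. -/
structure IsConvexGeometry {X : Type*} (φ : ClosureOperator (Set X)) : Prop where
  closure_empty : φ ∅ = ∅
  anti_exchange : ∀ Y : Set X, φ Y = Y → ∀ x ∉ Y, ∀ y ∉ Y, x ≠ y →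
    x ∈ φ (Y ∪ {y}) → y ∉ φ (Y ∪ {x})

/-- The convex geometries with base set `X`. -/
def ConvexGeometry (X : Type*) : Type _ :=
  {φ : ClosureOperator (Set X) // IsConvexGeometry φ}

/-- Two geometries on `X` are isomorphic if some permutation of `X` carries one closure operator to
the other. -/
def ConvexGeometry.isoSetoid (X : Type*) : Setoid (ConvexGeometry X) where
  r G H := ∃ e : X ≃ X, ∀ Y : Set X, e '' (G.1 Y) = H.1 (e '' Y)
  iseqv := by
    refine ⟨fun G => ⟨Equiv.refl X, by simp⟩, ?_, ?_⟩
    · rintro G H ⟨e, he⟩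
      refine ⟨e.symm, fun Y => ?_⟩
      have h := he (e.symm '' Y)
      rw [Equiv.image_symm_image] at h
      rw [← h, Equiv.symm_image_image]
    · rintro G H K ⟨e, he⟩ ⟨f, hf⟩
      refine ⟨e.trans f, fun Y => ?_⟩
      have h : ∀ Z : Set X, (e.trans f) '' Z = f '' (e '' Z) := fun Z => by
        rw [Set.image_image]; rfl
      rw [h, h, he, hf]

/-- The convex hull operator of a set `S` of circles in the plane: it sends `Y ⊆ S` to the set of
those circles of `S` all of whose points lie in the convex hull of the union of the circles
in `Y`. -/
def circleHull (S : Set (EuclideanGeometry.Sphere Plane)) (Y : Set S) : Set S :=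
  {x | (x.1 : Set Plane) ⊆ convexHull ℝ (⋃ y ∈ Y, (y.1 : Set Plane))}

/-- A geometry is representable by circles if it is isomorphic to a finite set `S` of circles, one
for each element of `X`, with the convex hull operator for circles. Circles of radius `0` (points)
are allowed. -/
def ConvexGeometry.IsRepresentableByCircles {X : Type*} (G : ConvexGeometry X) : Prop :=
  ∃ S : Set (EuclideanGeometry.Sphere Plane), S.Finite ∧ (∀ c ∈ S, 0 ≤ c.radius) ∧
    ∃ e : X ≃ S, ∀ Y : Set X, e '' (G.1 Y) = circleHull S (e '' Y)

/-! A closure operator is determined by its closed sets, and on a finite set the convex geometry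
axioms say that ∅ is closed and every proper closed set extends to a closed set by one point. On
four points the family of closed sets is a 16-bit number. Labelling the points along a complete
chain of closed sets fixes five of its bits. A search over the other eleven, pruned by closure under
intersection, shows that every geometry can be relabelled to one of 34 listed codes. No relabelling
turns one listed code into a different one, so the count is exact.

Each listed code comes with four integer circles. A circle is outside a hull if its support function
exceeds those of the generators in some direction (`not_subset_convexHull_biUnion_sphere`). It is
inside if its disc lies in a weighted Minkowski average of the generating discs
(`closedBall_subset_convexHull_biUnion_sphere`). Both certificates reduce to integer inequalities,
checked by evaluation. The circles thus realise the code, which yields both the existence of the 34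
geometries and representability. -/

/-! ### Closure operators and convex geometries -/

/-- Closure operators whose closed sets correspond under a bijection are isomorphic. -/
theorem ClosureOperator.image_eq_of_isClosed_iff {X X' : Type*} (φ : ClosureOperator (Set X))
    (ψ : ClosureOperator (Set X')) (e : X ≃ X')
    (h : ∀ Y : Set X, φ.IsClosed Y ↔ ψ.IsClosed (e '' Y)) (Y : Set X) :
    e '' (φ Y) = ψ (e '' Y) := by
  apply subset_antisymm
  · rw [Set.image_subset_iff]
    refine ClosureOperator.closure_min ?_ ?_
    · exact Set.image_subset_iff.1 (ψ.le_closure (e '' Y))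
    · rw [h, Set.image_preimage_eq _ e.surjective]
      exact ψ.isClosed_closure _
  · exact ClosureOperator.closure_min (Set.image_mono (φ.le_closure Y))
      ((h _).1 (φ.isClosed_closure Y))

theorem ClosureOperator.isClosed_iff_of_image_eq {X X' : Type*} {φ : ClosureOperator (Set X)}
    {ψ : ClosureOperator (Set X')} {e : X ≃ X'} (h : ∀ Y : Set X, e '' (φ Y) = ψ (e '' Y))
    (Y : Set X) : φ.IsClosed Y ↔ ψ.IsClosed (e '' Y) := by
  rw [φ.isClosed_iff, ψ.isClosed_iff]
  change φ Y = Y ↔ ψ (e '' Y) = e '' Y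
  rw [← h, e.injective.image_injective.eq_iff]

theorem ClosureOperator.IsClosed.inter {X : Type*} {φ : ClosureOperator (Set X)} {Y Z : Set X}
    (hY : φ.IsClosed Y) (hZ : φ.IsClosed Z) : φ.IsClosed (Y ∩ Z) := by
  rw [ClosureOperator.isClosed_iff_closure_le]
  exact Set.subset_inter (ClosureOperator.closure_min Set.inter_subset_left hY)
    (ClosureOperator.closure_min Set.inter_subset_right hZ)

/-- In a finite convex geometry every proper closed set extends to a closed set by one point. -/
theorem IsConvexGeometry.exists_isClosed_insert {X : Type*} [Finite X]
    {φ : ClosureOperator (Set X)} (hφ : IsConvexGeometry φ) {Y : Set X} (hY : φ.IsClosed Y)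
    (hne : Y ≠ Set.univ) : ∃ x ∉ Y, φ.IsClosed (insert x Y) := by
  -- For minimal `φ (Y ∪ {x})`, a further point `y` in it has the same closure over `Y`, against
  -- anti-exchange.
  obtain ⟨x, hx, hmin⟩ := (Set.toFinite Yᶜ).exists_minimalFor (fun x => φ (Y ∪ {x})) Yᶜ
    (Set.nonempty_compl.2 hne)
  refine ⟨x, hx, ?_⟩
  rw [ClosureOperator.isClosed_iff_closure_le]
  intro y hy
  by_contra hy'
  rw [Set.mem_insert_iff, not_or] at hy'
  rw [← Set.union_singleton] at hy
  have hle : φ (Y ∪ {y}) ≤ φ (Y ∪ {x}) := ClosureOperator.closure_min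
    (Set.union_subset (Set.subset_union_left.trans (φ.le_closure _))
      (Set.singleton_subset_iff.2 hy)) (φ.isClosed_closure _)
  exact hφ.anti_exchange Y hY.closure_eq y hy'.2 x hx hy'.1 hy
    (hmin hy'.2 hle (φ.le_closure (Y ∪ {x}) (by simp)))

/-- A closure operator on a finite set is a convex geometry as soon as `∅` is closed and every
proper closed set extends to a closed set by one point. -/
theorem isConvexGeometry_of_exists_isClosed_insert {X : Type*} [Finite X]
    {φ : ClosureOperator (Set X)} (h0 : φ.IsClosed ∅)
    (h : ∀ Y, φ.IsClosed Y → Y ≠ Set.univ → ∃ x ∉ Y, φ.IsClosed (insert x Y)) :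
    IsConvexGeometry φ := by
  refine ⟨h0.closure_eq, fun Y hY x hx y hy hxy hxφ hyφ => ?_⟩
  -- By maximality, the point `z` extending `W` must be `x` or `y`. Either choice is impossible: a
  -- closed set containing `Y` and one of the two contains the other.
  obtain ⟨W, hW⟩ := (Set.toFinite {W : Set X | φ.IsClosed W ∧ Y ⊆ W ∧ x ∉ W ∧ y ∉ W}).exists_maximal
    ⟨Y, φ.isClosed_iff.2 hY, subset_rfl, hx, hy⟩
  obtain ⟨hWc, hYW, hxW, hyW⟩ := hW.prop
  obtain ⟨z, hz, hzc⟩ := h W hWc (fun h => hxW (h ▸ Set.mem_univ x))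
  have key : ∀ u v : X, v ∉ W → u ≠ v → v ∈ φ (Y ∪ {u}) → z ≠ u := by
    rintro u v hv huv hvφ rfl
    have := ClosureOperator.closure_min (x := Y ∪ {z}) (y := insert z W)
      (Set.union_subset (hYW.trans (Set.subset_insert _ _)) (by simp)) hzc hvφ
    exact this.elim (fun h => huv h.symm) hv
  have hzx := key x y hyW hxy hyφ
  have hzy := key y x hxW hxy.symm hxφ
  have := hW.le_of_ge (y := insert z W) ⟨hzc, hYW.trans (Set.subset_insert _ _), by
    simp [hzx.symm, hxW], by simp [hzy.symm, hyW]⟩ (Set.subset_insert _ _)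
  exact hz (this (Set.mem_insert z W))

/-- In a convex geometry distinct points have distinct closures. -/
theorem IsConvexGeometry.closure_singleton_injective {X : Type*} {φ : ClosureOperator (Set X)}
    (hφ : IsConvexGeometry φ) : Function.Injective fun x => φ {x} := by
  intro x y hxy
  by_contra hne
  have hxy : φ {x} = φ {y} := hxy
  have hx : x ∈ φ {x} := φ.le_closure _ rfl
  have hy : y ∈ φ {y} := φ.le_closure _ rfl
  refine hφ.anti_exchange ∅ hφ.closure_empty x (by simp) y (by simp) hne ?_ ?_
  · simpa [← hxy] using hx
  · simpa [hxy] using hy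

/-! ### The convex hull operator of a family of circles -/

/-- The convex hull operator of a family of circles, transported to the index set. -/
noncomputable def sphereHull {X : Type*} (c : X → EuclideanGeometry.Sphere Plane) :
    ClosureOperator (Set X) :=
  ClosureOperator.mk₂
    (fun Y => {x | (c x : Set Plane) ⊆ convexHull ℝ (⋃ y ∈ Y, (c y : Set Plane))})
    (fun _ _ hy => (Set.subset_biUnion_of_mem (u := fun y => (c y : Set Plane)) hy).trans
      (subset_convexHull ℝ _))
    (fun _ _ hYZ _ hx => hx.trans (convexHull_min (Set.iUnion₂_subset hYZ) (convex_convexHull ℝ _)))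

theorem mem_sphereHull {X : Type*} (c : X → EuclideanGeometry.Sphere Plane) (Y : Set X) (x : X) :
    x ∈ sphereHull c Y ↔ (c x : Set Plane) ⊆ convexHull ℝ (⋃ y ∈ Y, (c y : Set Plane)) :=
  Iff.rfl

/-- Representability asks for a set of circles, so the family must be injective: equal circles would
give two points the same closure. -/
theorem ConvexGeometry.isRepresentableByCircles_of_eq_sphereHull {X : Type*} [Finite X]
    (G : ConvexGeometry X) (c : X → EuclideanGeometry.Sphere Plane) (hr : ∀ x, 0 ≤ (c x).radius)
    (h : G.1 = sphereHull c) : G.IsRepresentableByCircles := by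
  have hc : Function.Injective c := by
    intro x y hxy
    apply G.2.closure_singleton_injective
    ext z
    simp [h, mem_sphereHull, hxy]
  refine ⟨Set.range c, Set.finite_range c, by rintro _ ⟨x, rfl⟩; exact hr x,
    Equiv.ofInjective c hc, fun Y => ?_⟩
  ext ⟨_, x, rfl⟩
  have hx : (⟨c x, x, rfl⟩ : Set.range c) = Equiv.ofInjective c hc x := rfl
  rw [hx, (Equiv.ofInjective c hc).injective.mem_set_image, h, mem_sphereHull]
  simp [circleHull]

/-! ### Certificates for circles in convex hulls -/

/-- A weighted average of balls of radius at least the distance contains the given ball. -/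
theorem closedBall_subset_convexHull_biUnion_sphere {ι E : Type*} [Fintype ι]
    [NormedAddCommGroup E] [NormedSpace ℝ E] [Nontrivial E] (c : ι → E) (r w : ι → ℝ)
    (hr : ∀ i, 0 ≤ r i) (hw : ∀ i, 0 ≤ w i) (hw1 : ∑ i, w i = 1) {Y : Set ι}
    (hY : ∀ i, w i ≠ 0 → i ∈ Y) (p : E) (ρ : ℝ)
    (h : ‖p - ∑ i, w i • c i‖ + ρ ≤ ∑ i, w i * r i) :
    Metric.closedBall p ρ ⊆ convexHull ℝ (⋃ i ∈ Y, Metric.sphere (c i) (r i)) := by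
  intro q hq
  set P := ∑ i, w i • c i with hP
  set R := ∑ i, w i * r i with hR
  have hR0 : 0 ≤ R := Finset.sum_nonneg fun i _ => mul_nonneg (hw i) (hr i)
  have hqP : ‖q - P‖ ≤ R := by
    rw [mem_closedBall_iff_norm] at hq
    have := norm_add_le (q - p) (p - P)
    rw [sub_add_sub_cancel] at this
    linarith
  -- One vector `v` of the unit ball serves all discs: `q = P + R • v` is the average of the points
  -- `c i + r i • v`. If `R = 0`, then `q = P` and `v = 0` will do.
  obtain ⟨v, hv, hvq⟩ : ∃ v : E, ‖v‖ ≤ 1 ∧ R • v = q - P := by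
    rcases hR0.eq_or_lt with h0 | h0
    · refine ⟨0, by simp, ?_⟩
      rw [← h0] at hqP
      simpa using (norm_le_zero_iff.1 hqP).symm
    · refine ⟨R⁻¹ • (q - P), ?_, smul_inv_smul₀ h0.ne' _⟩
      rw [norm_smul, norm_inv, Real.norm_of_nonneg hR0, inv_mul_le_iff₀ h0]
      simpa using hqP
  have hq' : q = ∑ i, w i • (c i + r i • v) := by
    simp only [smul_add, Finset.sum_add_distrib, ← hP, smul_smul, ← Finset.sum_smul, ← hR, hvq]
    abel
  have hmem : ∀ i ∈ Y, c i + r i • v ∈ convexHull ℝ (⋃ i ∈ Y, Metric.sphere (c i) (r i)) := by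
    intro i hi
    refine convexHull_mono (Set.subset_biUnion_of_mem (u := fun i => Metric.sphere (c i) (r i)) hi) ?_
    rw [convexHull_sphere_eq_closedBall _ (hr i), mem_closedBall_iff_norm, add_sub_cancel_left,
      norm_smul, Real.norm_of_nonneg (hr i)]
    exact mul_le_of_le_one_right (hr i) hv
  rw [hq', ← Finset.sum_filter_add_sum_filter_not _ (fun i => w i ≠ 0)]
  rw [Finset.sum_eq_zero (s := {i | ¬ w i ≠ 0}) (by simp +contextual), add_zero]
  refine (convex_convexHull ℝ _).sum_mem (fun i _ => hw i) ?_ ?_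
  · rw [Finset.sum_filter_ne_zero, hw1]
  · intro i hi
    exact hmem i (hY i (Finset.mem_filter.1 hi).2)

/-- A circle that reaches further in some direction than each of a family of circles does not lie
in their convex hull. -/
theorem not_subset_convexHull_biUnion_sphere {ι E : Type*} [NormedAddCommGroup E]
    [InnerProductSpace ℝ E] (c : ι → E) (r : ι → ℝ) (Y : Set ι) (p : E) {ρ : ℝ} (hρ : 0 ≤ ρ)
    {u : E} (hu : u ≠ 0)
    (h : ∀ i ∈ Y, inner ℝ u (c i) + ‖u‖ * r i < inner ℝ u p + ‖u‖ * ρ) :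
    ¬ Metric.sphere p ρ ⊆ convexHull ℝ (⋃ i ∈ Y, Metric.sphere (c i) (r i)) := by
  intro hsub
  have hu' : ‖u‖ ≠ 0 := norm_ne_zero_iff.2 hu
  have hhull : convexHull ℝ (⋃ i ∈ Y, Metric.sphere (c i) (r i)) ⊆
      {q | inner ℝ u q < inner ℝ u p + ‖u‖ * ρ} := by
    refine convexHull_min (Set.iUnion₂_subset fun i hi q hq => ?_)
      (convex_halfSpace_lt (innerSL ℝ u).toLinearMap.isLinear _)
    have h1 := real_inner_le_norm u (q - c i)
    rw [mem_sphere_iff_norm.1 hq, inner_sub_right] at h1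
    have h2 := h i hi
    simp only [Set.mem_ofPred_eq]
    linarith
  -- The point of the circle extremal in direction `u`.
  have hmem : p + (ρ / ‖u‖) • u ∈ Metric.sphere p ρ := by
    rw [mem_sphere_iff_norm, add_sub_cancel_left, norm_smul, norm_div, norm_norm,
      div_mul_cancel₀ _ hu', Real.norm_of_nonneg hρ]
  have hlt := hhull (hsub hmem)
  simp only [Set.mem_ofPred_eq, inner_add_right, inner_smul_right,
    real_inner_self_eq_norm_sq] at hlt
  have : ρ / ‖u‖ * ‖u‖ ^ 2 = ‖u‖ * ρ := by field_simp
  linarith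

/-! ### Integer circles -/

/-- A circle with integer centre `(x, y)` and radius `r`, given as `(x, y, r)`. -/
abbrev IntCircle : Type := ℤ × ℤ × ℕ

/-- The circle in the plane with given integer data. -/
noncomputable def IntCircle.toSphere (c : IntCircle) : EuclideanGeometry.Sphere Plane :=
  ⟨!₂[(c.1 : ℝ), (c.2.1 : ℝ)], (c.2.2 : ℝ)⟩

/-- The maximum on the circle `c` of the linear functional with coefficients `d.1`, `d.2.1` and
norm `d.2.2`. -/
def IntCircle.height (d c : IntCircle) : ℤ := d.1 * c.1 + d.2.1 * c.2.1 + d.2.2 * c.2.2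

/-- The set of points of `Fin 4` whose bits are set in `s`. -/
def bitSet (s : ℕ) : Set (Fin 4) := {i | s.testBit i}

theorem mem_bitSet {s : ℕ} {i : Fin 4} : i ∈ bitSet s ↔ s.testBit i = true := Iff.rfl

/-- Some direction from a fixed list separates the circle `x` from those in `s`. -/
def SeparatedFrom (c : Fin 4 → IntCircle) (x : Fin 4) (s : ℕ) : Prop :=
  -- Axis and 3-4-5 directions have integer norm, so heights stay integers.
  ∃ d ∈ ([(1, 0, 1), (-1, 0, 1), (0, 1, 1), (0, -1, 1), (3, 4, 5), (3, -4, 5), (-3, 4, 5),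
    (-3, -4, 5), (4, 3, 5), (4, -3, 5), (-4, 3, 5), (-4, -3, 5)] : List IntCircle),
    ∀ y : Fin 4, s.testBit y = true → IntCircle.height d (c y) < IntCircle.height d (c x)

/-- The disc bounded by `x` lies in a weighted average of the discs of the family. -/
def InAverage (c : Fin 4 → IntCircle) (x : Fin 4) (w : Fin 4 → ℤ) : Prop :=
  let avg (f : IntCircle → ℤ) : ℤ := w 0 * (f (c 0) - f (c x)) + w 1 * (f (c 1) - f (c x)) +
    w 2 * (f (c 2) - f (c x)) + w 3 * (f (c 3) - f (c x))
  -- Distance of centres at most difference of radii, multiplied by the total weight and squared;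
  -- the sign condition makes squaring reversible.
  0 ≤ avg (fun a => a.2.2) ∧
    avg (fun a => a.1) ^ 2 + avg (fun a => a.2.1) ^ 2 ≤ avg (fun a => a.2.2) ^ 2

/-- The disc bounded by `x` lies in an average, with small integer weights, of those in `s`. -/
def InAverageOf (c : Fin 4 → IntCircle) (x : Fin 4) (s : ℕ) : Prop :=
  ∃ w₀ : Fin 3, (w₀ ≠ 0 → s.testBit 0 = true) ∧ ∃ w₁ : Fin 3, (w₁ ≠ 0 → s.testBit 1 = true) ∧
  ∃ w₂ : Fin 3, (w₂ ≠ 0 → s.testBit 2 = true) ∧ ∃ w₃ : Fin 3, (w₃ ≠ 0 → s.testBit 3 = true) ∧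
    (w₀.1 + w₁.1 + w₂.1 + w₃.1 ≠ 0) ∧ InAverage c x ![w₀.1, w₁.1, w₂.1, w₃.1]

/-- The closed sets of the convex hull operator of the circles `c` are certified to be the subsets
of `Fin 4` coded by the bits of `n`. -/
def IsCircleCode (c : Fin 4 → IntCircle) (n : ℕ) : Prop :=
  ∀ s < 16, if n.testBit s = true then ∀ x : Fin 4, s.testBit x = true ∨ SeparatedFrom c x s
    else ∃ x : Fin 4, ¬ s.testBit x = true ∧ InAverageOf c x s

instance (c : Fin 4 → IntCircle) (x : Fin 4) (s : ℕ) : Decidable (SeparatedFrom c x s) := by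
  unfold SeparatedFrom; infer_instance

instance (c : Fin 4 → IntCircle) (x : Fin 4) (w : Fin 4 → ℤ) : Decidable (InAverage c x w) := by
  unfold InAverage; infer_instance

instance (c : Fin 4 → IntCircle) (x : Fin 4) (s : ℕ) : Decidable (InAverageOf c x s) := by
  unfold InAverageOf; infer_instance

instance (c : Fin 4 → IntCircle) (n : ℕ) : Decidable (IsCircleCode c n) := by
  unfold IsCircleCode; infer_instance

theorem SeparatedFrom.not_subset {c : Fin 4 → IntCircle} {x : Fin 4} {s : ℕ}
    (h : SeparatedFrom c x s) : ¬ ((c x).toSphere : Set Plane) ⊆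
      convexHull ℝ (⋃ y ∈ bitSet s, ((c y).toSphere : Set Plane)) := by
  obtain ⟨d, hd, h⟩ := h
  have hd' : (d.1 ≠ 0 ∨ d.2.1 ≠ 0) ∧ d.1 ^ 2 + d.2.1 ^ 2 = (d.2.2 : ℤ) ^ 2 := by
    clear h; revert d; decide
  have hn : ‖(!₂[(d.1 : ℝ), (d.2.1 : ℝ)] : Plane)‖ = d.2.2 := by
    rw [EuclideanSpace.norm_eq, Real.sqrt_eq_iff_eq_sq (by positivity) (by positivity)]
    have := hd'.2
    simp only [Fin.sum_univ_two, Real.norm_eq_abs, sq_abs, Matrix.cons_val_zero,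
      Matrix.cons_val_one]
    exact_mod_cast this
  refine not_subset_convexHull_biUnion_sphere (fun i => (c i).toSphere.center)
    (fun i => (c i).toSphere.radius) (bitSet s) _ (by simp [IntCircle.toSphere])
    (u := !₂[(d.1 : ℝ), (d.2.1 : ℝ)]) ?_ ?_
  · intro h0
    have h1 := congrArg (fun v : Plane => v 0) h0
    have h2 := congrArg (fun v : Plane => v 1) h0
    simp at h1 h2
    tauto
  · intro i hi
    have := h i hi
    have h' : ((IntCircle.height d (c i) : ℤ) : ℝ) < (IntCircle.height d (c x) : ℤ) := by
      exact_mod_cast this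
    rw [hn]
    simp only [IntCircle.height] at h'
    push_cast at h'
    simp only [IntCircle.toSphere, PiLp.inner_apply, Fin.sum_univ_two]
    simp
    linarith

theorem InAverage.subset {c : Fin 4 → IntCircle} {x : Fin 4} {w : Fin 4 → ℕ} {Y : Set (Fin 4)}
    (h : InAverage c x fun i => w i) (h0 : w 0 + w 1 + w 2 + w 3 ≠ 0) (hY : ∀ i, w i ≠ 0 → i ∈ Y) :
    ((c x).toSphere : Set Plane) ⊆
      convexHull ℝ (⋃ y ∈ Y, ((c y).toSphere : Set Plane)) := by
  set D : ℝ := ((w 0 + w 1 + w 2 + w 3 : ℕ) : ℝ) with hD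
  have hD0 : 0 < D := by rw [hD]; exact_mod_cast Nat.pos_of_ne_zero h0
  refine Metric.sphere_subset_closedBall.trans (closedBall_subset_convexHull_biUnion_sphere
    (fun i => (c i).toSphere.center) (fun i => (c i).toSphere.radius) (fun i => w i / D)
    (fun i => by simp [IntCircle.toSphere]) (fun i => by positivity) ?_
    (fun i hi => hY i fun h => hi (by simp [h])) _ _ ?_)
  · rw [← Finset.sum_div, Fin.sum_univ_four, div_eq_one_iff_eq hD0.ne', hD]
    push_cast; ring
  · obtain ⟨h1, h2⟩ := h
    rw [← le_sub_iff_add_le, EuclideanSpace.norm_eq]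
    have h1' := (Int.cast_le (R := ℝ)).2 h1
    have h2' := (Int.cast_le (R := ℝ)).2 h2
    push_cast at h1' h2'
    push_cast at hD
    have key : ∀ f : Fin 4 → ℝ, ∑ i, w i / D * f i - f x = (w 0 * (f 0 - f x) +
        w 1 * (f 1 - f x) + w 2 * (f 2 - f x) + w 3 * (f 3 - f x)) / D := by
      intro f
      rw [Fin.sum_univ_four, eq_div_iff hD0.ne']
      field_simp
      rw [hD]; ring
    have k0 := key fun i => (c i).1
    have k1 := key fun i => (c i).2.1
    have k2 := key fun i => (c i).2.2
    apply Real.sqrt_le_iff.2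
    simp only [Fin.sum_univ_two, Real.norm_eq_abs, sq_abs]
    simp only [IntCircle.toSphere, PiLp.sub_apply, WithLp.ofLp_sum, Finset.sum_apply,
      smul_eq_mul, Pi.smul_apply, WithLp.ofLp_smul]
    simp only [Matrix.cons_val_zero, Matrix.cons_val_one]
    rw [sub_sq_comm, sub_sq_comm (((c x).2.1 : ℤ) : ℝ), k0, k1, k2, div_pow, div_pow, div_pow,
      ← add_div]
    exact ⟨by positivity, by gcongr⟩

theorem InAverageOf.subset {c : Fin 4 → IntCircle} {x : Fin 4} {s : ℕ} (h : InAverageOf c x s) :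
    ((c x).toSphere : Set Plane) ⊆
      convexHull ℝ (⋃ y ∈ bitSet s, ((c y).toSphere : Set Plane)) := by
  obtain ⟨w₀, h₀, w₁, h₁, w₂, h₂, w₃, h₃, h0, h⟩ := h
  refine InAverage.subset (w := ![w₀, w₁, w₂, w₃]) ?_ h0 ?_
  · convert h using 2 with i
    fin_cases i <;> rfl
  · intro i hi
    fin_cases i
    · exact h₀ fun h => hi (by simp [h])
    · exact h₁ fun h => hi (by simp [h])
    · exact h₂ fun h => hi (by simp [h])
    · exact h₃ fun h => hi (by simp [h])

/-! ### Codes of closure operators -/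

/-- The closed sets of `φ` are the images under `e` of the subsets of `Fin 4` coded by the bits
of `n`. -/
def HasCode {X : Type*} (φ : ClosureOperator (Set X)) (e : Fin 4 ≃ X) (n : ℕ) : Prop :=
  ∀ s < 16, n.testBit s = true ↔ φ.IsClosed (e '' bitSet s)

theorem IsCircleCode.hasCode {X : Type*} {c : Fin 4 → IntCircle} {n : ℕ} (h : IsCircleCode c n)
    (e : Fin 4 ≃ X) : HasCode (sphereHull fun x => (c (e.symm x)).toSphere) e n := by
  intro s hs
  have hs' := h s hs
  have hmem : ∀ x, e x ∈ sphereHull (fun x => (c (e.symm x)).toSphere) (e '' bitSet s) ↔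
      ((c x).toSphere : Set Plane) ⊆
        convexHull ℝ (⋃ y ∈ bitSet s, ((c y).toSphere : Set Plane)) := by
    intro x
    rw [mem_sphereHull, Set.biUnion_image]
    simp only [Equiv.symm_apply_apply]
  rw [ClosureOperator.isClosed_iff_closure_le]
  split_ifs at hs' with hn
  · simp only [hn, true_iff]
    intro y hy
    obtain ⟨x, rfl⟩ := e.surjective y
    rw [hmem] at hy
    rcases hs' x with h | h
    · exact Set.mem_image_of_mem e h
    · exact absurd hy h.not_subset
  · obtain ⟨x, hx, hxs⟩ := hs'
    refine iff_of_false hn fun hle => ?_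
    have := hle ((hmem x).2 hxs.subset)
    exact hx (e.injective.mem_set_image.1 this)

theorem exists_bitSet_eq (Y : Set (Fin 4)) : ∃ s < 16, bitSet s = Y := by
  classical
  refine ⟨Nat.ofBits fun i : Fin 4 => decide (i ∈ Y), Nat.ofBits_lt_two_pow _, ?_⟩
  ext i
  simp [mem_bitSet]

theorem exists_image_bitSet_eq {X : Type*} (e : Fin 4 ≃ X) (Y : Set X) :
    ∃ s < 16, e '' bitSet s = Y := by
  obtain ⟨s, hs, h⟩ := exists_bitSet_eq (e ⁻¹' Y)
  exact ⟨s, hs, by rw [h, Set.image_preimage_eq _ e.surjective]⟩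

theorem bitSet_zero : bitSet 0 = ∅ := by ext i; simp [mem_bitSet]

theorem bitSet_one : bitSet 1 = {0} := by
  ext i; rw [mem_bitSet, Set.mem_singleton_iff]; revert i; decide

theorem bitSet_three : bitSet 3 = {0, 1} := by
  ext i; rw [mem_bitSet, Set.mem_insert_iff, Set.mem_singleton_iff]; revert i; decide

theorem bitSet_seven : bitSet 7 = {0, 1, 2} := by
  ext i; rw [mem_bitSet, Set.mem_insert_iff, Set.mem_insert_iff, Set.mem_singleton_iff]
  revert i; decide

theorem bitSet_fifteen : bitSet 15 = Set.univ := by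
  ext i; simp only [mem_bitSet, Set.mem_univ, iff_true]; revert i; decide

theorem bitSet_land (s t : ℕ) : bitSet (s &&& t) = bitSet s ∩ bitSet t := by
  ext i; simp [mem_bitSet]

theorem bitSet_lor_two_pow (s : ℕ) (i : Fin 4) : bitSet (s ||| 2 ^ (i : ℕ)) = insert i (bitSet s) := by
  ext j
  rw [Set.mem_insert_iff, mem_bitSet, mem_bitSet, Nat.testBit_lor, Nat.testBit_two_pow,
    Bool.or_eq_true, decide_eq_true_iff, or_comm, Fin.ext_iff, eq_comm]

/-- The code of the preimage under `f` of the set with code `s`. -/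
def preimageCode (f : Fin 4 → Fin 4) (s : ℕ) : ℕ := Nat.ofBits fun i : Fin 4 => s.testBit (f i)

theorem preimageCode_lt (f : Fin 4 → Fin 4) (s : ℕ) : preimageCode f s < 16 :=
  Nat.ofBits_lt_two_pow _

theorem bitSet_preimageCode (f : Fin 4 → Fin 4) (s : ℕ) :
    bitSet (preimageCode f s) = f ⁻¹' bitSet s := by
  ext i; simp [mem_bitSet, preimageCode]

/-- The code of a family of sets after relabelling the points by the inverse of `f`. -/
def relabelCode (f : Fin 4 → Fin 4) (n : ℕ) : ℕ :=
  Nat.ofBits fun s : Fin 16 => n.testBit (preimageCode f s)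

theorem relabelCode_lt (f : Fin 4 → Fin 4) (n : ℕ) : relabelCode f n < 2 ^ 16 :=
  Nat.ofBits_lt_two_pow _

/-- The axioms of a convex geometry on `Fin 4`, for the code of the family of its closed sets. -/
def IsGeometryCode (n : ℕ) : Prop :=
  n.testBit 0 = true ∧
    (∀ s < 15, n.testBit s = true →
      ∃ i : Fin 4, ¬ s.testBit i = true ∧ n.testBit (s ||| 2 ^ (i : ℕ)) = true) ∧
    -- By symmetry of the intersection, pairs with `t < s` suffice.
    ∀ s < 16, n.testBit s = true → ∀ t < s, n.testBit t = true → n.testBit (s &&& t) = true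

instance (n : ℕ) : Decidable (IsGeometryCode n) := by unfold IsGeometryCode; infer_instance

section HasCode

variable {X : Type*} {φ : ClosureOperator (Set X)} {e : Fin 4 ≃ X} {n m : ℕ}

theorem exists_hasCode (φ : ClosureOperator (Set X)) (e : Fin 4 ≃ X) :
    ∃ n < 2 ^ 16, HasCode φ e n := by
  classical
  refine ⟨Nat.ofBits fun s : Fin 16 => decide (φ.IsClosed (e '' bitSet s)),
    Nat.ofBits_lt_two_pow _, fun s hs => ?_⟩
  rw [Nat.testBit_ofBits_lt _ _ hs, decide_eq_true_iff]

theorem HasCode.unique (hn : HasCode φ e n) (hm : HasCode φ e m) (hn' : n < 2 ^ 16)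
    (hm' : m < 2 ^ 16) : n = m := by
  refine Nat.eq_of_testBit_eq fun s => ?_
  rcases lt_or_ge s 16 with hs | hs
  · rw [Bool.eq_iff_iff, hn s hs, hm s hs]
  · have := Nat.pow_le_pow_right (n := 2) (by norm_num) hs
    rw [Nat.testBit_lt_two_pow (hn'.trans_le this), Nat.testBit_lt_two_pow (hm'.trans_le this)]

theorem HasCode.isClosed_iff {X' : Type*} {ψ : ClosureOperator (Set X')} {e' : Fin 4 ≃ X'}
    (h : HasCode φ e n) (h' : HasCode ψ e' n) (Y : Set X) :
    φ.IsClosed Y ↔ ψ.IsClosed ((e.symm.trans e') '' Y) := by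
  obtain ⟨s, hs, rfl⟩ := exists_image_bitSet_eq e Y
  rw [← h s hs, h' s hs, Set.image_image]
  simp

/-- The image of a set under `σ` is its preimage under `σ.symm`, hence the inverse in the new code.
-/
theorem HasCode.relabel (h : HasCode φ e n) (σ : Equiv.Perm (Fin 4)) :
    HasCode φ (σ.trans e) (relabelCode σ.symm n) := by
  intro s hs
  rw [relabelCode, Nat.testBit_ofBits_lt _ _ hs, h _ (preimageCode_lt _ _), bitSet_preimageCode,
    ← σ.image_eq_preimage_symm, Set.image_image]
  rfl

theorem HasCode.isGeometryCode (h : HasCode φ e n) (hφ : IsConvexGeometry φ) :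
    IsGeometryCode n := by
  have : Finite X := .of_equiv _ e
  refine ⟨?_, fun s hs hs' => ?_, fun s hs hs' t ht ht' => ?_⟩
  · rw [h 0 (by norm_num), bitSet_zero, Set.image_empty]
    exact φ.isClosed_iff.2 hφ.closure_empty
  · obtain ⟨x, hx, hxc⟩ := hφ.exists_isClosed_insert ((h s (by omega)).1 hs') (by
      rw [← Set.image_univ_of_surjective e.surjective, e.injective.image_injective.ne_iff]
      have hs'' : ∃ i : Fin 4, ¬ s.testBit i = true := by
        clear hs'; revert s; decide
      obtain ⟨i, hi⟩ := hs''
      exact fun h => hi (mem_bitSet.1 (h ▸ Set.mem_univ i)))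
    obtain ⟨i, rfl⟩ := e.surjective x
    refine ⟨i, fun hi => hx (Set.mem_image_of_mem e hi), ?_⟩
    rw [h _ (Nat.or_lt_two_pow (n := 4) (by omega) (Nat.pow_lt_pow_right (by norm_num) i.2)),
      bitSet_lor_two_pow, Set.image_insert_eq]
    exact hxc
  · have ht16 := ht.trans hs
    rw [h _ (Nat.and_lt_two_pow (n := 4) s ht16), bitSet_land, Set.image_inter e.injective]
    exact ((h s hs).1 hs').inter ((h t ht16).1 ht')

theorem HasCode.isConvexGeometry (h : HasCode φ e n) (hn : IsGeometryCode n) :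
    IsConvexGeometry φ := by
  have : Finite X := .of_equiv _ e
  obtain ⟨h0, h2, -⟩ := hn
  refine isConvexGeometry_of_exists_isClosed_insert ?_ fun Y hY hne => ?_
  · rwa [h 0 (by norm_num), bitSet_zero, Set.image_empty] at h0
  · obtain ⟨s, hs, rfl⟩ := exists_image_bitSet_eq e Y
    have hs' : s < 15 := by
      refine lt_of_le_of_ne (by omega) fun hs' => hne ?_
      rw [hs', bitSet_fifteen, Set.image_univ_of_surjective e.surjective]
    obtain ⟨i, hi, hin⟩ := h2 s hs' ((h s hs).2 hY)
    refine ⟨e i, fun hi' => hi (e.injective.mem_set_image.1 hi'), ?_⟩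
    rw [h _ (Nat.or_lt_two_pow (n := 4) hs (Nat.pow_lt_pow_right (by norm_num) i.2)),
      bitSet_lor_two_pow, Set.image_insert_eq] at hin
    exact hin

end HasCode

theorem nodup_iff_injective_vec {α : Type*} {a b c d : α} :
    [a, b, c, d].Nodup ↔ Function.Injective ![a, b, c, d] := by
  have hof : List.ofFn ![a, b, c, d] = [a, b, c, d] := by simp [List.ofFn_succ]
  rw [← List.nodup_ofFn, hof]

/-- A convex geometry on four points has a complete chain of closed sets. -/
theorem IsConvexGeometry.exists_closed_chain {X : Type*} {φ : ClosureOperator (Set X)}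
    (hφ : IsConvexGeometry φ) (hX : Nat.card X = 4) :
    ∃ e : Fin 4 ≃ X, ∀ s ∈ [0, 1, 3, 7, 15], φ.IsClosed (e '' bitSet s) := by
  have : Finite X := Nat.finite_of_card_ne_zero (by omega)
  have hne : ∀ Y : Set X, Y.ncard ≠ 4 → Y ≠ Set.univ := by
    rintro _ h rfl
    exact h (by rw [Set.ncard_univ, hX])
  have h0 : φ.IsClosed ∅ := φ.isClosed_iff.2 hφ.closure_empty
  obtain ⟨a, -, h1⟩ := hφ.exists_isClosed_insert h0 (hne _ (by simp))
  have c1 : (insert a (∅ : Set X)).ncard = 1 := by simp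
  obtain ⟨b, hb, h2⟩ := hφ.exists_isClosed_insert h1 (hne _ (by omega))
  have c2 := Set.ncard_insert_of_notMem hb
  obtain ⟨c, hc, h3⟩ := hφ.exists_isClosed_insert h2 (hne _ (by omega))
  have c3 := Set.ncard_insert_of_notMem hc
  obtain ⟨d, hd, h4⟩ := hφ.exists_isClosed_insert h3 (hne _ (by omega))
  have hinj : Function.Injective ![a, b, c, d] := by
    simp only [Set.mem_insert_iff, Set.mem_empty_iff_false, or_false, not_or] at hb hc hd
    rw [← nodup_iff_injective_vec]
    simp
    tauto
  have hbij : Function.Bijective ![a, b, c, d] := by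
    have := Fintype.ofFinite X
    rw [Fintype.bijective_iff_injective_and_card]
    exact ⟨hinj, by rw [← Nat.card_eq_fintype_card (α := X), hX, Fintype.card_fin]⟩
  refine ⟨Equiv.ofBijective _ hbij, ?_⟩
  simp only [List.forall_mem_cons, List.not_mem_nil, false_imp_iff, implies_true, and_true,
    bitSet_zero, bitSet_one, bitSet_three, bitSet_seven, bitSet_fifteen, Set.image_insert_eq,
    Set.image_singleton, Set.image_empty, Equiv.ofBijective_apply,
    Set.image_univ_of_surjective hbij.surjective]
  refine ⟨h0, by simpa using h1, ?_, ?_, φ.isClosed_top⟩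
  · convert h2 using 1
    simp [Set.pair_comm]
  · convert h3 using 1
    ext x
    simp
    tauto

/-! ### The classification -/

/-- Four circles for each isomorphism type of convex geometries on four points, together with the
code of the family of closed sets. -/
def circleTable : List (ℕ × (Fin 4 → IntCircle)) := [
  (50181, ![(0, 0, 3), (0, 0, 0), (0, 0, 2), (0, 0, 1)]),
  (50437, ![(0, 0, 2), (1, 0, 0), (0, 0, 1), (0, 0, 0)]),
  (35853, ![(0, 0, 1), (0, 0, 0), (0, 0, 2), (0, 1, 1)]),
  (45361, ![(0, 0, 1), (0, 0, 2), (0, 0, 0), (1, 1, 0)]),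
  (53589, ![(0, 0, 1), (0, -1, 0), (0, 0, 0), (0, 1, 0)]),
  (45875, ![(0, 0, 0), (0, 0, 1), (0, 1, 0), (1, 0, 0)]),
  (41137, ![(0, 0, 1), (0, 0, 2), (0, 0, 0), (1, 0, 2)]),
  (43779, ![(0, 1, 0), (0, 0, 1), (0, 1, 1), (0, 0, 0)]),
  (50373, ![(-1, 0, 2), (0, 0, 0), (0, 0, 1), (0, 1, 1)]),
  (61745, ![(0, -1, 1), (0, 0, 1), (0, 0, 0), (0, 1, 0)]),
  (41205, ![(0, 0, 1), (-1, -1, 1), (0, 0, 0), (0, 0, 2)]),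
  (49399, ![(-1, 0, 0), (1, 0, 0), (0, 0, 0), (1, 0, 1)]),
  (41215, ![(0, 0, 0), (-1, -1, 0), (1, 0, 0), (0, 0, 1)]),
  (45297, ![(0, 0, 1), (-1, 0, 1), (0, 0, 0), (1, 0, 1)]),
  (41659, ![(0, 0, 0), (0, -1, 1), (-1, 0, 0), (0, 1, 1)]),
  (53491, ![(-1, 0, 1), (0, 0, 1), (1, 0, 0), (1, 0, 1)]),
  (36063, ![(1, 0, 0), (0, 0, 0), (-1, 2, 2), (0, -1, 1)]),
  (35535, ![(0, 0, 0), (0, 1, 0), (-1, 1, 1), (1, 0, 1)]),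
  (50677, ![(1, -1, 1), (0, 0, 0), (1, 0, 0), (-1, 0, 0)]),
  (36815, ![(1, 0, 0), (0, 0, 0), (0, 1, 1), (1, -1, 0)]),
  (36317, ![(0, 0, 1), (-1, 0, 0), (0, -1, 1), (0, 1, 1)]),
  (63255, ![(2, -1, 2), (-1, 2, 2), (1, 1, 1), (0, 0, 0)]),
  (47903, ![(0, 0, 0), (-1, 0, 0), (2, 0, 0), (1, 0, 0)]),
  (56671, ![(-1, 2, 1), (0, 1, 0), (1, -1, 0), (0, 0, 0)]),
  (57183, ![(-1, 0, 1), (0, 1, 0), (1, 0, 1), (0, -1, 0)]),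
  (52429, ![(1, 0, 1), (0, 0, 0), (0, 0, 1), (0, -1, 1)]),
  (65297, ![(0, -1, 1), (1, 0, 1), (0, 1, 0), (0, 0, 0)]),
  (52701, ![(-1, 0, 1), (0, 0, 0), (0, 1, 0), (0, -1, 0)]),
  (61695, ![(-1, 0, 0), (0, -1, 0), (0, 0, 0), (0, 1, 1)]),
  (61943, ![(-1, 0, 0), (1, -1, 1), (0, 0, 0), (1, 1, 1)]),
  (48063, ![(0, 0, 0), (1, 1, 1), (0, -1, 0), (-1, 0, 0)]),
  (65399, ![(0, 1, 0), (0, -1, 0), (1, 0, 0), (0, 0, 0)]),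
  (57343, ![(0, -1, 0), (0, 0, 0), (-1, 1, 0), (1, 0, 0)]),
  (65535, ![(0, -1, 0), (-1, 1, 0), (0, 0, 0), (-1, 0, 0)])]

/-- The codes of the geometries in `circleTable`. -/
def tableCodes : List ℕ := circleTable.map Prod.fst

theorem isCircleCode_of_mem_circleTable : ∀ p ∈ circleTable, IsCircleCode p.2 p.1 := by
  decide +kernel

theorem isGeometryCode_of_mem_tableCodes : ∀ n ∈ tableCodes, IsGeometryCode n := by
  decide +kernel

theorem lt_of_mem_tableCodes : ∀ n ∈ tableCodes, n < 2 ^ 16 := by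
  decide +kernel

theorem card_toFinset_tableCodes : tableCodes.toFinset.card = 34 := by
  decide +kernel

/-- Permutations appear as explicit vectors without repetition, so that the non-isomorphism of the
listed geometries is a finite check. -/
theorem relabelCode_mem_tableCodes_of_nodup : ∀ a b c d : Fin 4, [a, b, c, d].Nodup →
    ∀ n ∈ tableCodes, relabelCode ![a, b, c, d] n ∈ tableCodes →
      relabelCode ![a, b, c, d] n = n := by
  decide +kernel

/-- Relabelling a geometry of the table never yields another one of the table. -/
theorem relabelCode_eq_of_mem_tableCodes {f : Fin 4 → Fin 4} (hf : Function.Injective f) {n : ℕ}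
    (hn : n ∈ tableCodes) (h : relabelCode f n ∈ tableCodes) : relabelCode f n = n := by
  have hvec : ![f 0, f 1, f 2, f 3] = f := by funext i; fin_cases i <;> rfl
  rw [← hvec] at hf h ⊢
  exact relabelCode_mem_tableCodes_of_nodup _ _ _ _ (nodup_iff_injective_vec.2 hf) n hn h

/-! ### Exhaustive search over intersection-closed families -/

/-- The property `P` holds for all numbers obtained from `n` by successively setting bits in `l`,
where the bit `s` may be set only if the bits `s &&& t` are set for all set bits `t < s`. -/
def ForallSettingBits (P : ℕ → Prop) : List ℕ → ℕ → Prop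
  | [], n => P n
  | s :: l, n => ForallSettingBits P l n ∧
    ((∀ t < s, n.testBit t = true → n.testBit (s &&& t) = true) →
      ForallSettingBits P l (n ||| 2 ^ s))

instance decidableForallSettingBits (P : ℕ → Prop) [DecidablePred P] :
    ∀ (l : List ℕ) (n : ℕ), Decidable (ForallSettingBits P l n)
  | [], n => inferInstanceAs (Decidable (P n))
  | _ :: l, _ =>
    have := decidableForallSettingBits P l
    inferInstanceAs (Decidable (_ ∧ (_ → _)))

/-- Following the branch that sets exactly the bits of `m` reaches `m`; the pruning never cuts this
branch when `m` is closed under intersections. -/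
theorem ForallSettingBits.apply {P : ℕ → Prop} {m : ℕ} : ∀ {l : List ℕ} {n : ℕ},
    ForallSettingBits P l n → l.Pairwise (· < ·) →
    (∀ s ∈ l, m.testBit s = true → ∀ t < s, m.testBit t = true → m.testBit (s &&& t) = true) →
    (∀ i, m.testBit i = (n.testBit i || (decide (i ∈ l) && m.testBit i))) → P m
  | [], n, h, _, _, hm => by
    obtain rfl : m = n := Nat.eq_of_testBit_eq fun i => by simpa using hm i
    exact h
  | s :: l, n, h, hl, hcl, hm => by
    rw [List.pairwise_cons] at hl
    have hcl' := fun s hs => hcl s (List.mem_cons_of_mem _ hs)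
    by_cases hs : m.testBit s = true
    · refine (h.2 fun t ht hnt => ?_).apply hl.2 hcl' fun i => ?_
      -- As `s &&& t < s` and `l` lies above `s`, this bit of `m` has already been decided, so it is
      -- also a bit of `n`.
      · have h1 := hcl s List.mem_cons_self hs t ht (by rw [hm t, hnt, Bool.true_or])
        have hlt : s &&& t < s := Nat.and_le_right.trans_lt ht
        have hnot : s &&& t ∉ s :: l := by
          rw [List.mem_cons, not_or]
          exact ⟨hlt.ne, fun h => (hl.1 _ h).not_gt hlt⟩
        rw [hm, decide_eq_false hnot, Bool.false_and, Bool.or_false] at h1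
        exact h1
      · have := hm i
        by_cases his : i = s
        · subst his; simp [hs]
        · simpa [his, Nat.testBit_two_pow, Ne.symm his] using this
    · refine h.1.apply hl.2 hcl' fun i => ?_
      have := hm i
      by_cases his : i = s
      · subst his; simpa [hs] using this
      · simpa [his] using this

/-- The number 32907 has exactly the bits 0, 1, 3, 7, 15 of the chain ∅, {0}, {0,1}, {0,1,2}, univ.
The list holds the remaining bits in increasing order. -/
theorem forallSettingBits_exists_relabelCode : ForallSettingBits
    (fun n => IsGeometryCode n → ∃ a b c d : Fin 4, [a, b, c, d].Nodup ∧
      relabelCode ![a, b, c, d] n ∈ tableCodes)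
    [2, 4, 5, 6, 8, 9, 10, 11, 12, 13, 14] 32907 := by
  decide +kernel

/-- Every convex geometry on `Fin 4` with a fixed complete chain of closed sets can be relabelled
to one in the table. -/
theorem IsGeometryCode.exists_relabelCode {n : ℕ} (hn : IsGeometryCode n) (hlt : n < 2 ^ 16)
    (hc : ∀ s ∈ [0, 1, 3, 7, 15], n.testBit s = true) :
    ∃ σ : Equiv.Perm (Fin 4), relabelCode σ.symm n ∈ tableCodes := by
  obtain ⟨a, b, c, d, hf, h⟩ := forallSettingBits_exists_relabelCode.apply (by decide)
    (fun s hs => hn.2.2 s (by clear * - hs; revert s; decide)) (fun i => by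
    simp only [List.forall_mem_cons, List.not_mem_nil, false_imp_iff, implies_true, and_true] at hc
    obtain ⟨h0, h1, h3, h7, h15⟩ := hc
    rcases lt_or_ge i 16 with hi | hi
    · interval_cases i <;> simp [*] <;>
        first | decide | exact fun h => absurd h (by decide)
    · have := Nat.pow_le_pow_right (n := 2) (by norm_num) hi
      rw [Nat.testBit_lt_two_pow (hlt.trans_le this), Nat.testBit_lt_two_pow (by omega)]
      simp) hn
  exact ⟨(Equiv.ofBijective _ (Finite.injective_iff_bijective.1
    (nodup_iff_injective_vec.1 hf))).symm, h⟩

theorem IsConvexGeometry.exists_hasCode_mem_tableCodes {X : Type*} {φ : ClosureOperator (Set X)}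
    (hφ : IsConvexGeometry φ) (hX : Nat.card X = 4) :
    ∃ e : Fin 4 ≃ X, ∃ n ∈ tableCodes, HasCode φ e n := by
  obtain ⟨e, he⟩ := hφ.exists_closed_chain hX
  obtain ⟨n, hlt, hn⟩ := exists_hasCode φ e
  obtain ⟨σ, hσ⟩ := (hn.isGeometryCode hφ).exists_relabelCode hlt fun s hs =>
    (hn s (by revert s; decide)).2 (he s hs)
  exact ⟨σ.trans e, _, hσ, hn.relabel σ⟩

theorem exists_sphereHull_hasCode {X : Type*} (e : Fin 4 ≃ X) {n : ℕ} (hn : n ∈ tableCodes) :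
    ∃ c : X → EuclideanGeometry.Sphere Plane, (∀ x, 0 ≤ (c x).radius) ∧
      HasCode (sphereHull c) e n := by
  obtain ⟨p, hp, rfl⟩ := List.mem_map.1 hn
  exact ⟨_, fun x => by simp [IntCircle.toSphere],
    (isCircleCode_of_mem_circleTable p hp).hasCode e⟩

/-- The hull operator of the circles supplies the closure operator; the axioms are then read off the
code. -/
theorem exists_convexGeometry_hasCode {X : Type*} (e : Fin 4 ≃ X) {n : ℕ} (hn : n ∈ tableCodes) :
    ∃ G : ConvexGeometry X, HasCode G.1 e n := by
  obtain ⟨c, -, hc⟩ := exists_sphereHull_hasCode e hn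
  exact ⟨⟨_, hc.isConvexGeometry (isGeometryCode_of_mem_tableCodes n hn)⟩, hc⟩

theorem card_quotient_isoSetoid {X : Type*} (hX : Nat.card X = 4) :
    Nat.card (Quotient (ConvexGeometry.isoSetoid X)) = 34 := by
  have : Finite X := Nat.finite_of_card_ne_zero (by omega)
  let e : Fin 4 ≃ X := (Finite.equivFinOfCardEq hX).symm
  choose G hG using fun n : tableCodes.toFinset =>
    exists_convexGeometry_hasCode e (List.mem_toFinset.1 n.2)
  have hbij : Function.Bijective fun n =>
      (⟦G n⟧ : Quotient (ConvexGeometry.isoSetoid X)) := by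
    constructor
    · intro n m hnm
      obtain ⟨f, hf⟩ := Quotient.exact hnm
      -- An isomorphism `f` gives `G m` the code `n` in the labelling `e.trans f`. Returning to the
      -- labelling `e` exhibits `m` as a relabelling of `n`, so the two listed codes agree.
      have hm : HasCode (G m).1 (e.trans f) n := by
        intro s hs
        rw [hG n s hs, ClosureOperator.isClosed_iff_of_image_eq hf, Set.image_image]
        rfl
      have h := hm.relabel ((e.trans f).trans e.symm).symm
      have he : (((e.trans f).trans e.symm).symm.trans (e.trans f)) = e := by ext; simp
      rw [he] at h
      have hnm' := h.unique (hG m) (relabelCode_lt _ _)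
        (lt_of_mem_tableCodes m (List.mem_toFinset.1 m.2))
      rw [Subtype.ext_iff, ← hnm', relabelCode_eq_of_mem_tableCodes (Equiv.injective _)
        (List.mem_toFinset.1 n.2)]
      rw [hnm']
      exact List.mem_toFinset.1 m.2
    · intro q
      induction q using Quotient.inductionOn with | _ H => ?_
      obtain ⟨e', n, hn, hH⟩ := H.2.exists_hasCode_mem_tableCodes hX
      exact ⟨⟨n, List.mem_toFinset.2 hn⟩, Quotient.sound ⟨e.symm.trans e',
        ClosureOperator.image_eq_of_isClosed_iff _ _ _ ((hG _).isClosed_iff hH)⟩⟩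
  rw [← Nat.card_congr (Equiv.ofBijective _ hbij), Nat.card_eq_fintype_card, Fintype.card_coe,
    card_toFinset_tableCodes]

theorem mainTheorem6 {X : Type*} (hX : Nat.card X = 4) :
    Nat.card (Quotient (ConvexGeometry.isoSetoid X)) = 34 ∧
      ∀ G : ConvexGeometry X, G.IsRepresentableByCircles := by
  refine ⟨card_quotient_isoSetoid hX, fun G => ?_⟩
  have : Finite X := Nat.finite_of_card_ne_zero (by omega)
  obtain ⟨e, n, hn, hG⟩ := G.2.exists_hasCode_mem_tableCodes hX
  obtain ⟨c, hr, hc⟩ := exists_sphereHull_hasCode e hn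
  refine G.isRepresentableByCircles_of_eq_sphereHull c hr
    (ClosureOperator.ext_isClosed _ _ fun Y => ?_)
  -- Both operators have code `n` in the same labelling `e`, so the comparing bijection is the
  -- identity.
  rw [hG.isClosed_iff hc]
  simp
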